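/- Let $F$ be a compact connected oriented smooth surface, possibly with boundary, and let $\mathsf{k}$ be a commutative ring containing $\mathbb{Q}$. Let $\mathfrak{C}(F)$ be the set of isotopy classes of curve systems, i.e. closed $1$-dimensional submanifolds of the interior of $F$ none of whose components bounds a disk (the empty system is included), and let $A=\mathsf{k}\mathfrak{C}(F)$ be the free $\mathsf{k}$-module on it. A diagram $D$ is a closed curve in the interior of $F$ with finitely many transverse double points, each carrying over/under information. Each crossing has two smoothings, $0$ and $\infty$, determined by the orientation of $F$ (with the over-strand along $x=y$ and the under-strand along $x=-y$ in an oriented chart, the $0$-smoothing consists of a left and a right arc and the $\infty$-smoothing of an upper and a lower arc). For curve systems $\alpha,\beta$ let $\alpha\triangleright\beta$ denote any diagram that is the union of representatives of $\alpha$ and $\beta$ in general position, whose crossings are exactly their intersection points, with $\alpha$ over $\beta$ at each of them. For a state $\sigma$ (a choice of smoothing at every crossing of $D$) let $\zeta(\sigma),\iota(\sigma)$ be the numbers of $0$- and $\infty$-smoothings, $\mu(\sigma)$ the number of components of the resulting curve that bound disks, and $D(\sigma)\in\mathfrak{C}(F)$ the class of the remaining components. The Kauffman bracket is $$\langle D\rangle=\sum_\sigma(-t)^{\zeta(\sigma)-\iota(\sigma)}(-t^2-t^{-2})^{\mu(\sigma)}D(\sigma)\in\mathsf{k}[t,t^{-1}]\mathfrak{C}(F),$$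 and $\langle D\rangle_n\in A$ denotes the coefficient of $h^n$ after the substitution $t=e^h$. The star product on $A$ defined by the Kauffman bracket is $\alpha\star\beta=\sum_{n\ge0}\lambda_n(\alpha,\beta)h^n$, where $\lambda_n\colon A\times A\to A$ is the $\mathsf{k}$-bilinear extension of $\lambda_n(\alpha,\beta)=\langle\alpha\triangleright\beta\rangle_n$ for $\alpha,\beta\in\mathfrak{C}(F)$, for a fixed but arbitrary choice of the diagrams $\alpha\triangleright\beta$. For $Q\in\mathsf{k}[z,w]$ and a diagram $D$ with set of crossings $C$ put $$\chi_Q(D)=\sum_{T\subset C}(-1)^{|T|}\sum_{\sigma\colon T\to\{0,\infty\}}a_{\iota(\sigma),\zeta(\sigma)}\,D_\sigma ,$$ where $a_{i,j}$ is the coefficient of $z^iw^j$ in $Q$ and $D_\sigma$ is the diagram obtained from $D$ by smoothing the crossings in $T$ according to $\sigma$. For $r\ge0$ let $\varphi_r(i)\in\mathbb{Q}$ be the coefficient of $h^{2r}$ in $(-e^{2h}-e^{-2h})^i$, and put $\varphi_r(D)=(-1)^{|C|}\sum_\sigma\varphi_r(\mu(\sigma))D(\sigma)\in A$, the sum being over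 all states of $D$. Extend $\chi_Q$ and $\varphi_r$ linearly. For $p\ge0$ let $D_p\subset\mathrm{End}_{\mathsf{k}}(A)$ be the set of all $\mathsf{k}$-linear combinations of endomorphisms of the form $$\beta\mapsto\varphi_{r_\ell}\chi_{Q_\ell}\bigl(\alpha_{\ell-1}\triangleright\cdots\varphi_{r_1}\chi_{Q_1}(\alpha_0\triangleright\varphi_0\chi_{Q_0}\beta)\cdots\bigr),$$ where $\ell\ge0$, $\alpha_i\in\mathfrak{C}(F)$, $r_i\ge0$, each $Q_i\in\mathsf{k}[z,w]$ is homogeneous of degree $q_i$, and $q_0+2r_1+q_1+\dots+2r_\ell+q_\ell\le p$; here each map $\gamma\mapsto\alpha_i\triangleright\gamma$ is the linear extension of any choice of diagrams $\alpha_i\triangleright\gamma$ for $\gamma\in\mathfrak{C}(F)$. **Theorem.** The sequence $D_0\subset D_1\subset\cdots$ is a filtered subalgebra of $\mathrm{End}_{\mathsf{k}}(A)$, i.e. it consists of increasing submodules with $\mathrm{id}\in D_0$ and $D_i\cdot D_j\subset D_{i+j}$ for all $i,j$, and the star product defined by the Kauffman bracket is $D$-differentiable: for all $n\ge0$ and all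 $a\in A$ the endomorphisms $\lambda_n(a,\cdot)$ and $\lambda_n(\cdot,a)$ belong to $D_n$, that is, they are $D$-operators of order $\le n$. -/

import Mathlib

open scoped Manifold ContDiff

noncomputable section

namespace KauffmanStar

/-! ### Filtered subalgebras and differentiability of star products -/

section Algebra

variable {k A : Type*} [CommRing k] [AddCommGroup A] [Module k A]

/-- A filtered subalgebra `D 0 ⊆ D 1 ⊆ ⋯` of `End_k(A)`. -/
structure IsFilteredSubalgebra (D : ℕ → Submodule k (Module.End k A)) : Prop where
  mono : Monotone D
  one_mem : (1 : Module.End k A) ∈ D 0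
  mul_mem : ∀ i j : ℕ, ∀ f ∈ D i, ∀ g ∈ D j, f * g ∈ D (i + j)

/-- A star product on `A`, i.e. a `k[[h]]`-bilinear product on `A[[h]]`, is recorded by the
sequence of its `k`-bilinear coefficients `coeff n : A × A → A`:
`a ⋆ b = ∑ₙ coeff n a b * h ^ n`. -/
structure StarProduct (k A : Type*) [CommRing k] [AddCommGroup A] [Module k A] where
  coeff : ℕ → A →ₗ[k] A →ₗ[k] A

/-- `D`-differentiability: for all `n`, the restrictions of the `n`-th coefficient to each of the
two variables are `D`-operators of order `≤ n`, i.e. elements of `D n`. -/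
def StarProduct.IsDifferentiable (s : StarProduct k A)
    (D : ℕ → Submodule k (Module.End k A)) : Prop :=
  ∀ (n : ℕ) (a : A), s.coeff n a ∈ D n ∧ (s.coeff n).flip a ∈ D n

end Algebra

/-! ### The plane, with a crossing and its two smoothings -/

/-- The oriented plane. -/
abbrev Plane : Type := EuclideanSpace ℝ (Fin 2)

/-- The standard over-strand (the diagonal). -/
def overStrand : Set Plane := {p | p 0 = p 1}

/-- The standard under-strand (the antidiagonal). -/
def underStrand : Set Plane := {p | p 0 = -p 1}

/-- The projection of the standard crossing. -/
def crossSet : Set Plane := overStrand ∪ underStrand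

/-- A smooth bump function: `1` at `0`, nonzero exactly on `(-1, 1)`. -/
def bump (y : ℝ) : ℝ := Real.smoothTransition (1 - y ^ 2)

/-- The `0`-smoothing `)(` of the standard crossing: two arcs, one in the left and one in the right
half-plane. It agrees with `crossSet` away from a compact set. -/
def smoothZero : Set Plane := {p | p 0 ^ 2 = p 1 ^ 2 + bump (p 1)}

/-- The `∞`-smoothing of the standard crossing: two arcs, one in the upper and one in the lower
half-plane. It agrees with `crossSet` away from a compact set. -/
def smoothInfty : Set Plane := {p | p 1 ^ 2 = p 0 ^ 2 + bump (p 0)}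

/-! ### Curve systems on an oriented surface -/

/-- The atlas of `F` is oriented: all coordinate changes have positive Jacobian determinant. -/
class OrientedAtlas (F : Type*) [TopologicalSpace F] [ChartedSpace (EuclideanHalfSpace 2) F] :
    Prop where
  det_pos : ∀ e ∈ atlas (EuclideanHalfSpace 2) F, ∀ e' ∈ atlas (EuclideanHalfSpace 2) F,
    ∀ x ∈ e.source ∩ e'.source,
      0 < (fderivWithin ℝ (e'.extend (𝓡∂ 2) ∘ (e.extend (𝓡∂ 2)).symm) (Set.range (𝓡∂ 2))
        (e.extend (𝓡∂ 2) x)).det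

section Curves

variable {F : Type*} [TopologicalSpace F] [ChartedSpace (EuclideanHalfSpace 2) F]

/-- `e` is a smooth, orientation preserving open embedding of the plane into the surface (it then
lands in the interior). The derivative `mfderiv` is the one in the preferred chart at `e x`. -/
structure IsOrientedParam (e : Plane → F) : Prop where
  isOpenEmbedding : Topology.IsOpenEmbedding e
  contMDiff : ContMDiff 𝓘(ℝ, Plane) (𝓡∂ 2) ∞ e
  det_pos : ∀ x, 0 < ContinuousLinearMap.det
    (show Plane →L[ℝ] Plane from mfderiv 𝓘(ℝ, Plane) (𝓡∂ 2) e x)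

/-- Near `p`, the set `S` is a smooth `1`-dimensional submanifold of the interior of `F`. -/
def IsFlatAt (S : Set F) (p : F) : Prop :=
  ∃ (e : Plane → F) (x : Plane), IsOrientedParam e ∧ e x = p ∧
    ∀ᶠ y in nhds x, (e y ∈ S ↔ y 1 = 0)

/-- `S` is a closed `1`-dimensional smooth submanifold of the interior of `F`. -/
structure IsCurve (S : Set F) : Prop where
  isClosed : IsClosed S
  flat : ∀ p ∈ S, IsFlatAt S p

/-- `K` is a circle that bounds a disk in `F`. -/
def BoundsDisk (K : Set F) : Prop :=
  ∃ e : Plane → F, IsOrientedParam e ∧ e '' Metric.sphere 0 1 = K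

/-- The set of inessential components of `S`. -/
def inessentialComponents (S : Set F) : Set (Set F) :=
  {K | (∃ x ∈ S, K = connectedComponentIn S x) ∧ BoundsDisk K}

/-- The union of the essential components of `S`. -/
def essentialPart (S : Set F) : Set F :=
  {x ∈ S | ¬ BoundsDisk (connectedComponentIn S x)}

/-- Smooth ambient isotopy of subsets of `F`. -/
def Isotopic (S S' : Set F) : Prop :=
  ∃ H : ℝ → (F ≃ₘ^∞⟮𝓡∂ 2, 𝓡∂ 2⟯ F),
    ContMDiff (𝓘(ℝ, ℝ).prod (𝓡∂ 2)) (𝓡∂ 2) ∞ (fun q : ℝ × F => H q.1 q.2) ∧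
      (∀ x, H 0 x = x) ∧ H 1 '' S = S'

theorem Isotopic.rfl' (S : Set F) : Isotopic S S := by
  refine ⟨fun _ => Diffeomorph.refl (𝓡∂ 2) F ∞, contMDiff_snd, fun x => rfl, ?_⟩
  simp

theorem Isotopic.symm' {S S' : Set F} (h : Isotopic S S') : Isotopic S' S := by
  obtain ⟨H, hs, h0, h1⟩ := h
  refine ⟨fun t => (H 1).symm.trans (H (1 - t)), ?_, fun x => ?_, ?_⟩
  · have h2 : ContMDiff (𝓘(ℝ, ℝ).prod (𝓡∂ 2)) (𝓘(ℝ, ℝ).prod (𝓡∂ 2)) ∞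
        (fun q : ℝ × F => ((1 - q.1, (H 1).symm q.2) : ℝ × F)) := by
      refine ContMDiff.prodMk ?_ ?_
      · have h3 : ContMDiff 𝓘(ℝ, ℝ) 𝓘(ℝ, ℝ) ∞ (fun t : ℝ => 1 - t) :=
          contMDiff_iff_contDiff.2 (contDiff_const.sub contDiff_id)
        exact h3.comp contMDiff_fst
      · exact (H 1).symm.contMDiff.comp contMDiff_snd
    exact hs.comp h2
  · simp
  · subst h1
    ext y
    simp [h0]

theorem Isotopic.trans' {S S' S'' : Set F} (h : Isotopic S S') (h' : Isotopic S' S'') :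
    Isotopic S S'' := by
  obtain ⟨H, hs, h0, h1⟩ := h
  obtain ⟨K, ks, k0, k1⟩ := h'
  refine ⟨fun t => (H t).trans (K t), ?_, fun x => ?_, ?_⟩
  · exact ks.comp (contMDiff_fst.prodMk hs)
  · simp [h0, k0]
  · subst h1
    subst k1
    ext y
    simp

variable (F) in
/-- A curve system: a closed `1`-dimensional submanifold of the interior of `F` without
inessential components. -/
structure CurveSystem where
  carrier : Set F
  isCurve : IsCurve carrier
  essential : ∀ x ∈ carrier, ¬ BoundsDisk (connectedComponentIn carrier x)

variable (F) in
instance curveSystemSetoid : Setoid (CurveSystem F) where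
  r S S' := Isotopic S.carrier S'.carrier
  iseqv := ⟨fun S => Isotopic.rfl' S.carrier, Isotopic.symm', Isotopic.trans'⟩

variable (F) in
/-- The set of isotopy classes of curve systems on `F`. -/
abbrev CurveClass : Type _ := Quotient (curveSystemSetoid F)

end Curves

/-! ### The standard smoothings are submanifolds of the plane -/

theorem contDiff_bump : ContDiff ℝ ∞ bump :=
  Real.smoothTransition.contDiff.comp (contDiff_const.sub (contDiff_id.pow 2))

theorem sq_add_bump_pos (y : ℝ) : 0 < y ^ 2 + bump y := by
  have h0 : 0 ≤ bump y := Real.smoothTransition.nonneg _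
  rcases eq_or_ne y 0 with rfl | hy
  · have : bump 0 = 1 := by simp [bump]
    rw [this]; norm_num
  · have : 0 < y ^ 2 := by positivity
    linarith

theorem bump_eq_zero {y : ℝ} (h : 1 ≤ y ^ 2) : bump y = 0 :=
  Real.smoothTransition.zero_of_nonpos (by linarith)

theorem bump_le_one (y : ℝ) : bump y ≤ 1 := Real.smoothTransition.le_one _

theorem mem_crossSet {p : Plane} : p ∈ crossSet ↔ p 0 ^ 2 = p 1 ^ 2 := by
  rw [sq_eq_sq_iff_eq_or_eq_neg]; rfl

theorem normSq_plane (p : Plane) : ‖p‖ ^ 2 = p 0 ^ 2 + p 1 ^ 2 := by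
  simp [EuclideanSpace.norm_sq_eq, Fin.sum_univ_two]

theorem mem_smoothZero_iff_of_far {p : Plane} (hp : p ∉ Metric.closedBall (0 : Plane) 2) :
    p ∈ smoothZero ↔ p ∈ crossSet := by
  have h4 : 4 < p 0 ^ 2 + p 1 ^ 2 := by
    rw [← normSq_plane]
    have : 2 < ‖p‖ := by simpa using hp
    nlinarith
  rw [mem_crossSet]
  have hb := bump_le_one (p 1)
  by_cases h : 1 ≤ p 1 ^ 2
  · simp [smoothZero, bump_eq_zero h]
  · push Not at h
    constructor
    · intro h'
      have h' : p 0 ^ 2 = p 1 ^ 2 + bump (p 1) := h'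
      linarith
    · intro h'
      linarith

theorem mem_smoothInfty_iff_of_far {p : Plane} (hp : p ∉ Metric.closedBall (0 : Plane) 2) :
    p ∈ smoothInfty ↔ p ∈ crossSet := by
  have h4 : 4 < p 0 ^ 2 + p 1 ^ 2 := by
    rw [← normSq_plane]
    have : 2 < ‖p‖ := by simpa using hp
    nlinarith
  rw [mem_crossSet]
  have hb := bump_le_one (p 0)
  by_cases h : 1 ≤ p 0 ^ 2
  · simp [smoothInfty, bump_eq_zero h, eq_comm]
  · push Not at h
    constructor
    · intro h'
      have h' : p 1 ^ 2 = p 0 ^ 2 + bump (p 0) := h'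
      linarith
    · intro h'
      linarith

theorem continuous_coord (i : Fin 2) : Continuous fun p : Plane => p i := by fun_prop

theorem isClosed_smoothZero : IsClosed smoothZero :=
  isClosed_eq ((continuous_coord 0).pow 2)
    (((continuous_coord 1).pow 2).add (contDiff_bump.continuous.comp (continuous_coord 1)))

theorem isClosed_smoothInfty : IsClosed smoothInfty :=
  isClosed_eq ((continuous_coord 1).pow 2)
    (((continuous_coord 0).pow 2).add (contDiff_bump.continuous.comp (continuous_coord 0)))

/-- A smooth, orientation preserving open embedding of the plane into itself. -/
structure IsPlaneParam (e : Plane → Plane) : Prop where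
  isOpenEmbedding : Topology.IsOpenEmbedding e
  contDiff : ContDiff ℝ ∞ e
  det_pos : ∀ x, 0 < (fderiv ℝ e x).det

theorem IsPlaneParam.of_injective {e : Plane → Plane} (hi : Function.Injective e)
    (hc : ContDiff ℝ ∞ e) (hd : ∀ x, 0 < (fderiv ℝ e x).det) : IsPlaneParam e := by
  refine ⟨.of_continuous_injective_isOpenMap hc.continuous hi ?_, hc, hd⟩
  refine isOpenMap_of_hasStrictFDerivAt_equiv
    (f' := fun x => (fderiv ℝ e x).toContinuousLinearEquivOfDetNeZero (hd x).ne') fun x => ?_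
  simpa using hc.contDiffAt.hasStrictFDerivAt (by simp)

theorem det_plane (L : Plane →L[ℝ] Plane) {a b c d : ℝ}
    (h0 : ∀ v, L v 0 = a * v 0 + b * v 1) (h1 : ∀ v, L v 1 = c * v 0 + d * v 1) :
    L.det = a * d - b * c := by
  have : (L : Plane →ₗ[ℝ] Plane).toMatrix (EuclideanSpace.basisFun (Fin 2) ℝ).toBasis
      (EuclideanSpace.basisFun (Fin 2) ℝ).toBasis = !![a, b; c, d] := by
    ext i j
    fin_cases i <;> fin_cases j <;> simp [LinearMap.toMatrix_apply, h0, h1]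
  rw [ContinuousLinearMap.det, ← LinearMap.det_toMatrix
    (EuclideanSpace.basisFun (Fin 2) ℝ).toBasis, this, Matrix.det_fin_two_of]

theorem hasFDerivAt_coord (i : Fin 2) (x : Plane) :
    HasFDerivAt (fun p : Plane => p i) (EuclideanSpace.proj i : Plane →L[ℝ] ℝ) x :=
  (EuclideanSpace.proj i : Plane →L[ℝ] ℝ).hasFDerivAt

theorem fderiv_coord {e : Plane → Plane} (hc : ContDiff ℝ ∞ e) {x : Plane} {i : Fin 2}
    {L : Plane →L[ℝ] ℝ} (h : HasFDerivAt (fun p => e p i) L x) (v : Plane) :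
    fderiv ℝ e x v i = L v := by
  have h1 : HasFDerivAt e (fderiv ℝ e x) x := (hc.differentiable (by simp) x).hasFDerivAt
  have h2 : HasFDerivAt (fun p => e p i)
      ((EuclideanSpace.proj i : Plane →L[ℝ] ℝ).comp (fderiv ℝ e x)) x :=
    (hasFDerivAt_coord i (e x)).comp x h1
  rw [← h2.unique h]
  rfl

theorem isPlaneParam_shearZero {f : ℝ → ℝ} (hf : ContDiff ℝ ∞ f) :
    IsPlaneParam fun p => !₂[f (p 0) - p 1, p 0] := by
  have hc : ContDiff ℝ ∞ fun p : Plane => (!₂[f (p 0) - p 1, p 0] : Plane) := by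
    rw [contDiff_euclidean]
    intro i
    fin_cases i
    · simp only [Fin.zero_eta, Matrix.cons_val_zero]
      exact (hf.comp (by fun_prop)).sub (by fun_prop)
    · simp only [Fin.mk_one, Matrix.cons_val_one, Matrix.cons_val_fin_one]
      fun_prop
  refine IsPlaneParam.of_injective ?_ hc fun x => ?_
  · intro p q h
    have h0 := congrArg (fun v : Plane => v 0) h
    have h1 := congrArg (fun v : Plane => v 1) h
    simp only [Matrix.cons_val_zero, Matrix.cons_val_one, Matrix.cons_val_fin_one] at h0 h1
    rw [h1] at h0
    ext i
    fin_cases i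
    · exact h1
    · simpa using h0
  · have hf' : HasDerivAt f (deriv f (x 0)) (x 0) :=
      (hf.differentiable (by simp) (x 0)).hasDerivAt
    rw [det_plane (a := deriv f (x 0)) (b := -1) (c := 1) (d := 0)]
    · norm_num
    · intro v
      rw [fderiv_coord hc (L := deriv f (x 0) • (EuclideanSpace.proj 0 : Plane →L[ℝ] ℝ) -
        (EuclideanSpace.proj 1 : Plane →L[ℝ] ℝ))]
      · simp [sub_eq_add_neg]
      · exact (hf'.comp_hasFDerivAt x (hasFDerivAt_coord 0 x)).sub (hasFDerivAt_coord 1 x)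
    · intro v
      rw [fderiv_coord hc (L := (EuclideanSpace.proj 0 : Plane →L[ℝ] ℝ))]
      · simp
      · exact hasFDerivAt_coord 0 x

theorem isPlaneParam_shearInfty {f : ℝ → ℝ} (hf : ContDiff ℝ ∞ f) :
    IsPlaneParam fun p => !₂[p 0, f (p 0) + p 1] := by
  have hc : ContDiff ℝ ∞ fun p : Plane => (!₂[p 0, f (p 0) + p 1] : Plane) := by
    rw [contDiff_euclidean]
    intro i
    fin_cases i
    · simp only [Fin.zero_eta, Matrix.cons_val_zero]
      fun_prop
    · simp only [Fin.mk_one, Matrix.cons_val_one, Matrix.cons_val_fin_one]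
      exact (hf.comp (by fun_prop)).add (by fun_prop)
  refine IsPlaneParam.of_injective ?_ hc fun x => ?_
  · intro p q h
    have h0 := congrArg (fun v : Plane => v 0) h
    have h1 := congrArg (fun v : Plane => v 1) h
    simp only [Matrix.cons_val_zero, Matrix.cons_val_one, Matrix.cons_val_fin_one] at h0 h1
    rw [h0] at h1
    ext i
    fin_cases i
    · exact h0
    · simpa using h1
  · have hf' : HasDerivAt f (deriv f (x 0)) (x 0) :=
      (hf.differentiable (by simp) (x 0)).hasDerivAt
    rw [det_plane (a := 1) (b := 0) (c := deriv f (x 0)) (d := 1)]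
    · norm_num
    · intro v
      rw [fderiv_coord hc (L := (EuclideanSpace.proj 0 : Plane →L[ℝ] ℝ))]
      · simp
      · exact hasFDerivAt_coord 0 x
    · intro v
      rw [fderiv_coord hc (L := deriv f (x 0) • (EuclideanSpace.proj 0 : Plane →L[ℝ] ℝ) +
        (EuclideanSpace.proj 1 : Plane →L[ℝ] ℝ))]
      · simp
      · exact (hf'.comp_hasFDerivAt x (hasFDerivAt_coord 0 x)).add (hasFDerivAt_coord 1 x)

theorem contDiff_branch : ContDiff ℝ ∞ fun y : ℝ => √(y ^ 2 + bump y) :=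
  ((contDiff_id.pow 2).add contDiff_bump).sqrt fun y => (sq_add_bump_pos y).ne'

/-- A value `c` whose square is `y ^ 2 + bump y` lies on a smooth nowhere vanishing branch. -/
theorem exists_branch {y c : ℝ} (h : c ^ 2 = y ^ 2 + bump y) :
    ∃ f : ℝ → ℝ, ContDiff ℝ ∞ f ∧ f y = c ∧ (∀ t, f t ^ 2 = t ^ 2 + bump t) ∧ c ≠ 0 := by
  have hc : c ≠ 0 := by
    rintro rfl
    have := sq_add_bump_pos y
    norm_num at h
    linarith
  have hs : c = √(y ^ 2 + bump y) ∨ c = -√(y ^ 2 + bump y) := by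
    rw [← sq_eq_sq_iff_eq_or_eq_neg, Real.sq_sqrt (sq_add_bump_pos y).le, h]
  rcases hs with hs | hs
  · exact ⟨_, contDiff_branch, hs.symm, fun t => Real.sq_sqrt (sq_add_bump_pos t).le, hc⟩
  · refine ⟨_, contDiff_branch.neg, hs.symm, fun t => ?_, hc⟩
    simp only [neg_sq]
    exact Real.sq_sqrt (sq_add_bump_pos t).le

theorem flat_smoothZero {p : Plane} (hp : p ∈ smoothZero) :
    ∃ (e : Plane → Plane) (x : Plane), IsPlaneParam e ∧ e x = p ∧
      ∀ᶠ y in nhds x, (e y ∈ smoothZero ↔ y 1 = 0) := by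
  obtain ⟨f, hf, hfy, hsq, hne⟩ := exists_branch (y := p 1) (c := p 0) hp
  refine ⟨_, !₂[p 1, 0], isPlaneParam_shearZero hf, ?_, ?_⟩
  · ext i
    fin_cases i <;> simp [hfy]
  · have hcont : Continuous fun y : Plane => 2 * f (y 0) - y 1 :=
      ((hf.continuous.comp (continuous_coord 0)).const_mul 2).sub (continuous_coord 1)
    have hev := hcont.continuousAt.eventually_ne (x := (!₂[p 1, 0] : Plane)) (y := 0)
      (by simpa [hfy] using hne)
    filter_upwards [hev] with y hy
    have h1 : ((!₂[f (y 0) - y 1, y 0] : Plane) ∈ smoothZero) ↔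
        (f (y 0) - y 1) ^ 2 = f (y 0) ^ 2 := by
      rw [hsq]; rfl
    rw [h1]
    constructor
    · intro h
      have : y 1 * (2 * f (y 0) - y 1) = 0 := by linarith
      exact (mul_eq_zero.1 this).resolve_right hy
    · intro h
      rw [h, sub_zero]

theorem flat_smoothInfty {p : Plane} (hp : p ∈ smoothInfty) :
    ∃ (e : Plane → Plane) (x : Plane), IsPlaneParam e ∧ e x = p ∧
      ∀ᶠ y in nhds x, (e y ∈ smoothInfty ↔ y 1 = 0) := by
  obtain ⟨f, hf, hfy, hsq, hne⟩ := exists_branch (y := p 0) (c := p 1) hp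
  refine ⟨_, !₂[p 0, 0], isPlaneParam_shearInfty hf, ?_, ?_⟩
  · ext i
    fin_cases i <;> simp [hfy]
  · have hcont : Continuous fun y : Plane => 2 * f (y 0) + y 1 :=
      ((hf.continuous.comp (continuous_coord 0)).const_mul 2).add (continuous_coord 1)
    have hev := hcont.continuousAt.eventually_ne (x := (!₂[p 0, 0] : Plane)) (y := 0)
      (by simpa [hfy] using hne)
    filter_upwards [hev] with y hy
    have h1 : ((!₂[y 0, f (y 0) + y 1] : Plane) ∈ smoothInfty) ↔
        (f (y 0) + y 1) ^ 2 = f (y 0) ^ 2 := by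
      rw [hsq]; rfl
    rw [h1]
    constructor
    · intro h
      have : y 1 * (2 * f (y 0) + y 1) = 0 := by linarith
      exact (mul_eq_zero.1 this).resolve_right hy
    · intro h
      rw [h, add_zero]

section Surface

variable {F : Type*}

open Classical in
/-- The plane smoothing used at the crossing `c`: the `∞`-smoothing if `c ∈ I`, and the
`0`-smoothing otherwise. -/
def localSmoothing (I : Finset F) (c : F) : Set Plane :=
  if c ∈ I then smoothInfty else smoothZero

theorem isClosed_localSmoothing (I : Finset F) (c : F) : IsClosed (localSmoothing I c) := by
  unfold localSmoothing
  split_ifs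
  · exact isClosed_smoothInfty
  · exact isClosed_smoothZero

theorem mem_localSmoothing_of_far (I : Finset F) (c : F) {x : Plane}
    (hx : x ∉ Metric.closedBall (0 : Plane) 2) : x ∈ localSmoothing I c ↔ x ∈ crossSet := by
  unfold localSmoothing
  split_ifs
  · exact mem_smoothInfty_iff_of_far hx
  · exact mem_smoothZero_iff_of_far hx

theorem flat_localSmoothing (I : Finset F) (c : F) {p : Plane} (hp : p ∈ localSmoothing I c) :
    ∃ (e : Plane → Plane) (x : Plane), IsPlaneParam e ∧ e x = p ∧
      ∀ᶠ y in nhds x, (e y ∈ localSmoothing I c ↔ y 1 = 0) := by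
  unfold localSmoothing at hp ⊢
  split_ifs at hp ⊢
  · exact flat_smoothInfty hp
  · exact flat_smoothZero hp

variable [TopologicalSpace F] [ChartedSpace (EuclideanHalfSpace 2) F]

theorem IsOrientedParam.comp {c : Plane → F} {e : Plane → Plane} (hc : IsOrientedParam c)
    (he : IsPlaneParam e) : IsOrientedParam (c ∘ e) := by
  refine ⟨hc.isOpenEmbedding.comp he.isOpenEmbedding, hc.contMDiff.comp he.contDiff.contMDiff,
    fun x => ?_⟩
  have h : mfderiv 𝓘(ℝ, Plane) (𝓡∂ 2) (c ∘ e) x =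
      (mfderiv 𝓘(ℝ, Plane) (𝓡∂ 2) c (e x)).comp (mfderiv 𝓘(ℝ, Plane) 𝓘(ℝ, Plane) e x) :=
    mfderiv_comp x (hc.contMDiff.mdifferentiable (by simp) _)
      (he.contDiff.contMDiff.mdifferentiable (by simp) _)
  rw [h, mfderiv_eq_fderiv]
  have h2 := mul_pos (hc.det_pos (e x)) (he.det_pos x)
  have h3 := LinearMap.det_comp
    (((show Plane →L[ℝ] Plane from mfderiv 𝓘(ℝ, Plane) (𝓡∂ 2) c (e x)) : Plane →ₗ[ℝ] Plane))
    ((fderiv ℝ e x : Plane →L[ℝ] Plane) : Plane →ₗ[ℝ] Plane)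
  exact lt_of_lt_of_eq h2 h3.symm

/-- Flatness is a local property. -/
theorem IsFlatAt.congr {S S' : Set F} {p : F} (h : IsFlatAt S p)
    (hS : ∀ᶠ q in nhds p, (q ∈ S' ↔ q ∈ S)) : IsFlatAt S' p := by
  obtain ⟨e, x, he, rfl, hx⟩ := h
  refine ⟨e, x, he, rfl, ?_⟩
  filter_upwards [hx, he.isOpenEmbedding.continuous.continuousAt.eventually hS] with y h1 h2
  rw [h2, h1]

/-- Every point of a curve has a neighbourhood in which the curve stays in one component. -/
theorem IsFlatAt.eventually_connectedComponentIn {S : Set F} {p : F} (h : IsFlatAt S p)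
    (hp : p ∈ S) : ∀ᶠ q in nhds p, q ∈ S → q ∈ connectedComponentIn S p := by
  obtain ⟨e, x, he, rfl, hx⟩ := h
  obtain ⟨r, hr, hball⟩ := Metric.eventually_nhds_iff_ball.1 hx
  have hconv : Convex ℝ (Metric.ball x r ∩ {y : Plane | y 1 = 0}) := by
    refine (convex_ball x r).inter ?_
    intro y hy z hz a b _ _ _
    have hy : y 1 = 0 := hy
    have hz : z 1 = 0 := hz
    simp [hy, hz]
  have hx0 : x 1 = 0 := (hball x (Metric.mem_ball_self hr)).1 hp
  have hsub : e '' (Metric.ball x r ∩ {y : Plane | y 1 = 0}) ⊆ connectedComponentIn S (e x) := by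
    refine (hconv.isPreconnected.image e
      he.isOpenEmbedding.continuous.continuousOn).subset_connectedComponentIn
      ⟨x, ⟨Metric.mem_ball_self hr, hx0⟩, rfl⟩ ?_
    rintro _ ⟨y, ⟨hy1, hy2⟩, rfl⟩
    exact (hball y hy1).2 hy2
  have hn : e '' Metric.ball x r ∈ nhds (e x) :=
    he.isOpenEmbedding.isOpenMap.image_mem_nhds (Metric.ball_mem_nhds x hr)
  filter_upwards [hn] with q hq hqS
  obtain ⟨y, hy, rfl⟩ := hq
  exact hsub ⟨y, ⟨hy, (hball y hy).1 hqS⟩, rfl⟩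

theorem mem_essentialPart_iff_of_near {S : Set F} (hS : IsCurve S) {p : F} (hp : p ∈ S) :
    ∀ᶠ q in nhds p, q ∈ S → (q ∈ essentialPart S ↔ p ∈ essentialPart S) := by
  filter_upwards [(hS.flat p hp).eventually_connectedComponentIn hp] with q hq hqS
  have := connectedComponentIn_eq (hq hqS)
  simp only [essentialPart, Set.mem_ofPred_eq, hqS, hp, true_and, this]

theorem IsCurve.essentialPart {S : Set F} (hS : IsCurve S) : IsCurve (essentialPart S) := by
  constructor
  · rw [← isOpen_compl_iff, isOpen_iff_mem_nhds]
    intro p hp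
    by_cases hpS : p ∈ S
    · filter_upwards [mem_essentialPart_iff_of_near hS hpS] with q hq hqe
      exact hp ((hq hqe.1).1 hqe)
    · filter_upwards [hS.isClosed.isOpen_compl.mem_nhds hpS] with q hq hqe
      exact hq hqe.1
  · intro p hp
    refine (hS.flat p hp.1).congr ?_
    filter_upwards [mem_essentialPart_iff_of_near hS hp.1] with q hq
    exact ⟨fun h => h.1, fun h => (hq h).2 hp⟩

theorem connectedComponentIn_essentialPart {S : Set F} {p : F} (hp : p ∈ essentialPart S) :
    connectedComponentIn (essentialPart S) p = connectedComponentIn S p := by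
  apply subset_antisymm
  · exact connectedComponentIn_mono p fun q hq => hq.1
  · refine isPreconnected_connectedComponentIn.subset_connectedComponentIn
      (mem_connectedComponentIn hp.1) fun q hq => ⟨connectedComponentIn_subset _ _ hq, ?_⟩
    rw [← connectedComponentIn_eq hq]
    exact hp.2

/-- The curve system that consists of the essential components of a curve. -/
def IsCurve.toCurveSystem {S : Set F} (hS : IsCurve S) : CurveSystem F where
  carrier := KauffmanStar.essentialPart S
  isCurve := hS.essentialPart
  essential := fun p hp => by
    rw [connectedComponentIn_essentialPart hp]
    exact hp.2

/-! ### Diagrams and their smoothings -/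

variable (F) in
/-- A link diagram on `F`: a closed curve with finitely many transverse double points. Every
crossing `c` comes with an oriented parametrization `chart c` of a neighbourhood (the
neighbourhoods being disjoint) in which the diagram is the standard crossing and the diagonal is
the over-strand. (The values of `chart` at other points are irrelevant.) -/
structure Diagram where
  carrier : Set F
  crossings : Finset F
  chart : F → Plane → F
  isClosed : IsClosed carrier
  chart_param : ∀ c ∈ crossings, IsOrientedParam (chart c)
  chart_zero : ∀ c ∈ crossings, chart c 0 = c
  chart_cross : ∀ c ∈ crossings, chart c ⁻¹' carrier = crossSet
  disjoint : ∀ c ∈ crossings, ∀ c' ∈ crossings, c ≠ c' →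
    Disjoint (Set.range (chart c)) (Set.range (chart c'))
  flat : ∀ p ∈ carrier, p ∉ crossings → IsFlatAt carrier p

namespace Diagram

/-- The projection after smoothing the crossings in `T`. -/
def smoothCarrier (D : Diagram F) (T I : Finset F) : Set F :=
  {q ∈ D.carrier | ∀ c ∈ D.crossings, c ∈ T → q ∉ Set.range (D.chart c)} ∪
    {q | ∃ c ∈ D.crossings, c ∈ T ∧ q ∈ D.chart c '' localSmoothing I c}

variable (D : Diagram F) (T I : Finset F)

theorem chart_inj {c c' : F} (hc : c ∈ D.crossings) (hc' : c' ∈ D.crossings) {x x' : Plane}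
    (h : D.chart c x = D.chart c' x') : c = c' ∧ x = x' := by
  by_cases hcc : c = c'
  · subst hcc
    exact ⟨rfl, (D.chart_param c hc).isOpenEmbedding.injective h⟩
  · exact absurd ⟨x', h.symm⟩
      (Set.disjoint_left.1 (D.disjoint c hc c' hc' hcc) (Set.mem_range_self x))

/-- Inside the neighbourhood of a smoothed crossing one sees the plane smoothing. -/
theorem chart_mem_smoothCarrier {c : F} (hc : c ∈ D.crossings) (hcT : c ∈ T) (x : Plane) :
    D.chart c x ∈ D.smoothCarrier T I ↔ x ∈ localSmoothing I c := by
  constructor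
  · rintro (⟨_, h⟩ | ⟨c', hc', _, x', hx', h⟩)
    · exact absurd (Set.mem_range_self x) (h c hc hcT)
    · obtain ⟨rfl, rfl⟩ := D.chart_inj hc' hc h
      exact hx'
  · intro hx
    exact Or.inr ⟨c, hc, hcT, x, hx, rfl⟩

/-- Away from the compact cores of the smoothed crossings nothing changes. -/
theorem mem_smoothCarrier_of_far {q : F}
    (hq : ∀ c ∈ D.crossings, c ∈ T → q ∉ D.chart c '' Metric.closedBall (0 : Plane) 2) :
    q ∈ D.smoothCarrier T I ↔ q ∈ D.carrier := by
  by_cases h : ∃ c ∈ D.crossings, c ∈ T ∧ q ∈ Set.range (D.chart c)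
  · obtain ⟨c, hc, hcT, x, rfl⟩ := h
    have hx : x ∉ Metric.closedBall (0 : Plane) 2 := fun hx => hq c hc hcT ⟨x, hx, rfl⟩
    rw [D.chart_mem_smoothCarrier T I hc hcT, mem_localSmoothing_of_far I c hx,
      ← D.chart_cross c hc]
    rfl
  · push Not at h
    constructor
    · rintro (⟨h', _⟩ | ⟨c, hc, hcT, x, _, rfl⟩)
      · exact h'
      · exact absurd (Set.mem_range_self x) (h c hc hcT)
    · exact fun h' => Or.inl ⟨h', h⟩

theorem eventually_mem_smoothCarrier [T2Space F] {q : F}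
    (hq : ∀ c ∈ D.crossings, c ∈ T → q ∉ Set.range (D.chart c)) :
    ∀ᶠ q' in nhds q, (q' ∈ D.smoothCarrier T I ↔ q' ∈ D.carrier) := by
  have h : ∀ᶠ q' in nhds q, ∀ c ∈ D.crossings, c ∈ T →
      q' ∉ D.chart c '' Metric.closedBall (0 : Plane) 2 := by
    rw [Filter.eventually_all_finset]
    intro c hc
    by_cases hcT : c ∈ T
    · have hcl : IsClosed (D.chart c '' Metric.closedBall (0 : Plane) 2) :=
        ((isCompact_closedBall 0 2).image
          (D.chart_param c hc).isOpenEmbedding.continuous).isClosed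
      filter_upwards [hcl.isOpen_compl.mem_nhds
        (fun hmem => hq c hc hcT (Set.image_subset_range _ _ hmem))] with q' hq' _
      exact hq'
    · exact Filter.Eventually.of_forall fun _ h => absurd h hcT
  filter_upwards [h] with q' hq'
  exact D.mem_smoothCarrier_of_far T I hq'

open Classical in
/-- The diagram obtained by smoothing the crossings in `T`: those in `I` by the `∞`-smoothing and
the others by the `0`-smoothing. -/
def smooth [T2Space F] : Diagram F where
  carrier := D.smoothCarrier T I
  crossings := D.crossings \ T
  chart := D.chart
  isClosed := by
    rw [← isOpen_compl_iff, isOpen_iff_mem_nhds]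
    intro q hq
    by_cases h : ∃ c ∈ D.crossings, c ∈ T ∧ q ∈ Set.range (D.chart c)
    · obtain ⟨c, hc, hcT, x, rfl⟩ := h
      have hx : x ∈ (localSmoothing I c)ᶜ := fun hx =>
        hq ((D.chart_mem_smoothCarrier T I hc hcT x).2 hx)
      filter_upwards [(D.chart_param c hc).isOpenEmbedding.isOpenMap.image_mem_nhds
        ((isClosed_localSmoothing I c).isOpen_compl.mem_nhds hx)] with q' hq'
      obtain ⟨y, hy, rfl⟩ := hq'
      exact fun hmem => hy ((D.chart_mem_smoothCarrier T I hc hcT y).1 hmem)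
    · push Not at h
      have hev := D.eventually_mem_smoothCarrier T I h
      have hqD : q ∉ D.carrier := fun hmem => hq (hev.self_of_nhds.2 hmem)
      filter_upwards [hev, D.isClosed.isOpen_compl.mem_nhds hqD] with q' h1 h2
      exact fun hmem => h2 (h1.1 hmem)
  chart_param := fun c hc => D.chart_param c (Finset.mem_sdiff.1 hc).1
  chart_zero := fun c hc => D.chart_zero c (Finset.mem_sdiff.1 hc).1
  chart_cross := fun c hc => by
    obtain ⟨hc, hcT⟩ := Finset.mem_sdiff.1 hc
    rw [← D.chart_cross c hc]
    ext x
    refine D.mem_smoothCarrier_of_far T I fun c' hc' hcT' hmem => ?_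
    obtain ⟨y, _, hy⟩ := hmem
    exact hcT ((D.chart_inj hc' hc hy).1 ▸ hcT')
  disjoint := fun c hc c' hc' =>
    D.disjoint c (Finset.mem_sdiff.1 hc).1 c' (Finset.mem_sdiff.1 hc').1
  flat := fun p hp hpc => by
    by_cases h : ∃ c ∈ D.crossings, c ∈ T ∧ p ∈ Set.range (D.chart c)
    · obtain ⟨c, hc, hcT, x, rfl⟩ := h
      have hx := (D.chart_mem_smoothCarrier T I hc hcT x).1 hp
      obtain ⟨e, y, he, rfl, hy⟩ := flat_localSmoothing I c hx
      refine ⟨D.chart c ∘ e, y, (D.chart_param c hc).comp he, rfl, ?_⟩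
      filter_upwards [hy] with z hz
      rw [← hz]
      exact D.chart_mem_smoothCarrier T I hc hcT (e z)
    · push Not at h
      have hev := D.eventually_mem_smoothCarrier T I h
      refine (D.flat p (hev.self_of_nhds.1 hp) fun hpD => ?_).congr hev
      by_cases hpT : p ∈ T
      · exact h p hpD hpT ⟨0, D.chart_zero p hpD⟩
      · exact hpc (Finset.mem_sdiff.2 ⟨hpD, hpT⟩)

theorem isCurve_of_crossings_eq_empty (h : D.crossings = ∅) : IsCurve D.carrier :=
  ⟨D.isClosed, fun p hp => D.flat p hp (by simp [h])⟩

variable [T2Space F]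

/-- The projection after smoothing all crossings is a curve. -/
theorem isCurve_smooth : IsCurve (D.smooth D.crossings I).carrier :=
  (D.smooth D.crossings I).isCurve_of_crossings_eq_empty (by simp [smooth])

/-- `μ`: the number of inessential circles of the state in which exactly the crossings in `I`
carry the marker `∞`. -/
def inessentialCount (D : Diagram F) (I : Finset F) : ℕ :=
  (inessentialComponents (D.smooth D.crossings I).carrier).ncard

/-- The isotopy class of the curve system formed by the essential circles of the state in which
exactly the crossings in `I` carry the marker `∞`. -/
def stateClass (D : Diagram F) (I : Finset F) : CurveClass F :=
  ⟦(D.isCurve_smooth I).toCurveSystem⟧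

end Diagram

/-- A curve system, regarded as a diagram without crossings. -/
def CurveSystem.toDiagram (S : CurveSystem F) : Diagram F where
  carrier := S.carrier
  crossings := ∅
  chart := fun c _ => c
  isClosed := S.isCurve.isClosed
  chart_param := by simp
  chart_zero := by simp
  chart_cross := by simp
  disjoint := by simp
  flat := fun p hp _ => S.isCurve.flat p hp

/-- `D` is a diagram `α ▷ β`: it is the union of representatives of `α` and `β` in general
position, its crossings are exactly the intersection points, and at each of them `α` lies
over `β`. -/
def Diagram.IsOver (D : Diagram F) (α β : CurveClass F) : Prop :=
  ∃ S S' : CurveSystem F, ⟦S⟧ = α ∧ ⟦S'⟧ = β ∧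
    D.carrier = S.carrier ∪ S'.carrier ∧
    (D.crossings : Set F) = S.carrier ∩ S'.carrier ∧
    ∀ c ∈ D.crossings, D.chart c ⁻¹' S.carrier = overStrand ∧
      D.chart c ⁻¹' S'.carrier = underStrand

variable (F) in
/-- A choice of a diagram `α ▷ β` for all pairs of curve systems. -/
structure OverChoice where
  diagram : CurveClass F → CurveClass F → Diagram F
  isOver : ∀ α β, (diagram α β).IsOver α β

/-! ### The Kauffman bracket and its expansion -/

section Bracket

variable (k : Type*) [CommRing k]

/-- The value `-t² - t⁻²` of an inessential circle. -/
def loopValue : LaurentPolynomial k := -LaurentPolynomial.T 2 - LaurentPolynomial.T (-2)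

variable [Algebra ℚ k]

/-- `e^h` as a unit of `k[[h]]`. -/
def expUnit : (PowerSeries k)ˣ :=
  Units.mkOfMulEqOne (PowerSeries.exp k) (PowerSeries.evalNegHom (PowerSeries.exp k))
    PowerSeries.exp_mul_exp_neg_eq_one

/-- The substitution `t = e^h`, a homomorphism `k[t, t⁻¹] → k[[h]]`. -/
def substExp : LaurentPolynomial k →+* PowerSeries k :=
  LaurentPolynomial.eval₂ (PowerSeries.C (R := k)) (expUnit k)

/-- The coefficient of `h ^ j` of a Laurent polynomial in `t = e^h`. -/
def hCoeff (j : ℕ) (p : LaurentPolynomial k) : k := PowerSeries.coeff j (substExp k p)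

theorem hCoeff_zero (j : ℕ) : hCoeff k j 0 = 0 := by simp [hCoeff]

/-- `φ_j(i)`: the coefficient of `h ^ (2 * j)` in `(-t² - t⁻²) ^ i` with `t = e^h`. -/
def loopCoeff (j i : ℕ) : k := hCoeff k (2 * j) (loopValue k ^ i)

variable [T2Space F]

open Classical in
/-- The Kauffman bracket state sum `⟨D⟩`: the sum over all states of
`(-t) ^ (ζ - ι) * (-t² - t⁻²) ^ μ` times the class of the essential circles. A state is given by
the set `I` of crossings with marker `∞`, so that `ι = |I|` and `ζ = |C \ I|`; note that
`(-1) ^ (ζ - ι) = (-1) ^ |C|`. -/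
def bracket (D : Diagram F) : CurveClass F →₀ LaurentPolynomial k :=
  ∑ I ∈ D.crossings.powerset, Finsupp.single (D.stateClass I)
    ((-1) ^ D.crossings.card *
      LaurentPolynomial.T (((D.crossings \ I).card : ℤ) - (I.card : ℤ)) *
        loopValue k ^ D.inessentialCount I)

/-- `⟨D⟩_j`, the coefficient of `h ^ j` of the Kauffman bracket under `t = e^h`. -/
def bracketCoeff (j : ℕ) (D : Diagram F) : CurveClass F →₀ k :=
  (bracket k D).mapRange (hCoeff k j) (hCoeff_zero k j)

/-- The star product on `k𝔆(F)` defined by the Kauffman bracket: the `k`-bilinear extension of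
`λ_j(α, β) = ⟨α ▷ β⟩_j`. -/
def kauffmanStar (w : OverChoice F) : StarProduct k (CurveClass F →₀ k) where
  coeff := fun j => Finsupp.lift _ k (CurveClass F) fun α =>
    Finsupp.lift _ k (CurveClass F) fun β => bracketCoeff k j (w.diagram α β)

/-! ### Resolution operators and the combinatorial filtration -/

variable {k}

open Classical in
/-- The resolution operator `χ_Q` for a polynomial `Q ∈ k[z, w]` (`z = X 0`, `w = X 1`). It sums
over all ways to smooth a subset `T` of the crossings, with `(-1) ^ |T|` times the coefficient of
`z ^ ι * w ^ ζ` in `Q` as weight, where `ι = |I|` and `ζ = |T \ I|` are the numbers of `∞`- and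
`0`-smoothings. -/
def chi (Q : MvPolynomial (Fin 2) k) : (Diagram F →₀ k) →ₗ[k] (Diagram F →₀ k) :=
  Finsupp.lift _ k (Diagram F) fun D =>
    ∑ T ∈ D.crossings.powerset, ∑ I ∈ T.powerset,
      Finsupp.single (D.smooth T I)
        ((-1) ^ T.card * Q.coeff (Finsupp.single 0 I.card + Finsupp.single 1 (T \ I).card))

/-- The projection `φ_*` defined by a map `φ : ℕ → k`. It sums over all states with weight
`(-1) ^ |C| * φ(μ)`, and discards the inessential circles. -/
def phiStar (φ : ℕ → k) : (Diagram F →₀ k) →ₗ[k] (CurveClass F →₀ k) :=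
  Finsupp.lift _ k (Diagram F) fun D =>
    ∑ I ∈ D.crossings.powerset,
      Finsupp.single (D.stateClass I) ((-1) ^ D.crossings.card * φ (D.inessentialCount I))

/-- The projection `φ_r = (φ_r)_*`. -/
def phi (r : ℕ) : (Diagram F →₀ k) →ₗ[k] (CurveClass F →₀ k) := phiStar (loopCoeff k r)

/-- Curve systems as diagrams without crossings, extended linearly. -/
def inclusion : (CurveClass F →₀ k) →ₗ[k] (Diagram F →₀ k) :=
  Finsupp.lmapDomain k k fun β => β.out.toDiagram

/-- `IsWord n f` says that `f` is an endomorphism of `k𝔆(F)` of the form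
`β ↦ φ_{r_ℓ} χ_{Q_ℓ} (α_{ℓ-1} ▷ ⋯ φ_{r_1} χ_{Q_1} (α_0 ▷ φ_0 χ_{Q_0} β) ⋯)`
with `Q_i` homogeneous of degree `q_i` and `q_0 + 2 r_1 + q_1 + ⋯ + 2 r_ℓ + q_ℓ = n`.
Each `γ ↦ α ▷ γ` is the linear extension of any choice `d` of diagrams of `α` over curve
systems `γ`. -/
inductive IsWord : ℕ → Module.End k (CurveClass F →₀ k) → Prop
  | base (q : ℕ) (Q : MvPolynomial (Fin 2) k) (hQ : Q.IsHomogeneous q) :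
      IsWord q (phi 0 ∘ₗ chi Q ∘ₗ inclusion)
  | step (n : ℕ) (f : Module.End k (CurveClass F →₀ k)) (hf : IsWord n f)
      (α : CurveClass F) (d : CurveClass F → Diagram F) (hd : ∀ γ, (d γ).IsOver α γ)
      (r q : ℕ) (Q : MvPolynomial (Fin 2) k) (hQ : Q.IsHomogeneous q) :
      IsWord (n + (2 * r + q)) (phi r ∘ₗ chi Q ∘ₗ Finsupp.lmapDomain k k d ∘ₗ f)

variable (k F) in
/-- The combinatorial filtration: `D_p` consists of the linear combinations of words of
order `≤ p`. -/
def combFiltration (p : ℕ) : Submodule k (Module.End k (CurveClass F →₀ k)) :=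
  Submodule.span k {f | ∃ n ≤ p, IsWord n f}

end Bracket

end Surface

end KauffmanStar

end

noncomputable section

namespace KauffmanStar

section Surface

variable {F : Type*} [TopologicalSpace F] [ChartedSpace (EuclideanHalfSpace 2) F]

/-! ### Diagrams with equal states -/

theorem IsCurve.mk_toCurveSystem_congr {S S' : Set F} (h : S = S') (hS : IsCurve S)
    (hS' : IsCurve S') :
    (⟦hS.toCurveSystem⟧ : CurveClass F) = ⟦hS'.toCurveSystem⟧ := by
  subst h; rfl

namespace Diagram

theorem stateClass_congr [T2Space F] {D D' : Diagram F} {I I' : Finset F}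
    (h : D.smoothCarrier D.crossings I = D'.smoothCarrier D'.crossings I') :
    D.stateClass I = D'.stateClass I' :=
  IsCurve.mk_toCurveSystem_congr h _ _

theorem inessentialCount_congr [T2Space F] {D D' : Diagram F} {I I' : Finset F}
    (h : D.smoothCarrier D.crossings I = D'.smoothCarrier D'.crossings I') :
    D.inessentialCount I = D'.inessentialCount I' :=
  congrArg (fun S => (inessentialComponents S).ncard) h

open Classical in
/-- Smoothing the crossings in two steps is the same as smoothing them all at once. -/
theorem smoothCarrier_smooth [T2Space F] (D : Diagram F) {T A B : Finset F}
    (hA : A ⊆ T) (hB : B ⊆ D.crossings \ T) :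
    (D.smooth T A).smoothCarrier (D.smooth T A).crossings B =
      D.smoothCarrier D.crossings (A ∪ B) := by
  have hlA : ∀ c ∈ T, localSmoothing (A ∪ B) c = localSmoothing A c := by
    intro c hc
    have : c ∉ B := fun h => (Finset.mem_sdiff.1 (hB h)).2 hc
    simp [localSmoothing, this]
  have hlB : ∀ c ∉ T, localSmoothing (A ∪ B) c = localSmoothing B c := by
    intro c hc
    have : c ∉ A := fun h => hc (hA h)
    simp [localSmoothing, this]
  ext q
  by_cases h : ∃ c ∈ D.crossings, q ∈ Set.range (D.chart c)
  · obtain ⟨c, hc, x, rfl⟩ := h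
    rw [D.chart_mem_smoothCarrier D.crossings (A ∪ B) hc hc]
    by_cases hcT : c ∈ T
    · rw [hlA c hcT, ← D.chart_mem_smoothCarrier T A hc hcT]
      refine (D.smooth T A).mem_smoothCarrier_of_far _ _ fun c' hc' _ ⟨y, _, hy⟩ => ?_
      obtain ⟨hc', hcT'⟩ := Finset.mem_sdiff.1 hc'
      exact hcT' ((D.chart_inj hc' hc hy).1 ▸ hcT)
    · rw [hlB c hcT]
      have hc' : c ∈ (D.smooth T A).crossings := Finset.mem_sdiff.2 ⟨hc, hcT⟩
      exact (D.smooth T A).chart_mem_smoothCarrier _ B hc' hc' x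
  · push Not at h
    rw [D.mem_smoothCarrier_of_far _ _ fun c hc _ hq =>
      h c hc (Set.image_subset_range _ _ hq)]
    rw [(D.smooth T A).mem_smoothCarrier_of_far _ _ fun c hc _ hq =>
      h c (Finset.mem_sdiff.1 hc).1 (Set.image_subset_range _ _ hq)]
    exact D.mem_smoothCarrier_of_far _ _ fun c hc _ hq =>
      h c hc (Set.image_subset_range _ _ hq)

end Diagram

theorem CurveSystem.smoothCarrier_toDiagram (S : CurveSystem F) (T I : Finset F) :
    S.toDiagram.smoothCarrier T I = S.carrier := by
  ext q
  exact S.toDiagram.mem_smoothCarrier_of_far T I fun c hc => absurd hc (Finset.notMem_empty c)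

/-! ### The mirror image of a diagram -/

/-- The rotation of the plane by a quarter turn. -/
def quarterTurn (p : Plane) : Plane := !₂[-p 1, p 0]

theorem isPlaneParam_quarterTurn : IsPlaneParam quarterTurn := by
  have := isPlaneParam_shearZero (f := fun _ => 0) contDiff_const
  simp only [zero_sub] at this
  exact this

theorem quarterTurn_bijective : Function.Bijective quarterTurn := by
  refine ⟨isPlaneParam_quarterTurn.isOpenEmbedding.injective, fun p => ⟨!₂[p 1, -p 0], ?_⟩⟩
  ext i
  fin_cases i <;> simp [quarterTurn]

theorem quarterTurn_preimage_overStrand : quarterTurn ⁻¹' overStrand = underStrand := by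
  ext p
  simp only [quarterTurn, overStrand, underStrand, Set.mem_preimage, Set.mem_ofPred_eq,
    Matrix.cons_val_zero, Matrix.cons_val_one, Matrix.cons_val_fin_one]
  exact eq_comm

theorem quarterTurn_preimage_underStrand : quarterTurn ⁻¹' underStrand = overStrand := by
  ext p
  simp only [quarterTurn, overStrand, underStrand, Set.mem_preimage, Set.mem_ofPred_eq,
    Matrix.cons_val_zero, Matrix.cons_val_one, Matrix.cons_val_fin_one, neg_inj]
  exact eq_comm

theorem bump_neg (y : ℝ) : bump (-y) = bump y := by simp [bump]

theorem quarterTurn_preimage_smoothZero : quarterTurn ⁻¹' smoothZero = smoothInfty := by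
  ext p
  simp [quarterTurn, smoothZero, smoothInfty]

theorem quarterTurn_preimage_smoothInfty : quarterTurn ⁻¹' smoothInfty = smoothZero := by
  ext p
  simp [quarterTurn, smoothZero, smoothInfty, bump_neg]

namespace Diagram

/-- The diagram with the same projection in which all crossings are reversed. -/
def mirror (D : Diagram F) : Diagram F where
  carrier := D.carrier
  crossings := D.crossings
  chart := fun c => D.chart c ∘ quarterTurn
  isClosed := D.isClosed
  chart_param := fun c hc => (D.chart_param c hc).comp isPlaneParam_quarterTurn
  chart_zero := fun c hc => by
    have : quarterTurn 0 = 0 := by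
      ext i
      fin_cases i <;> simp [quarterTurn]
    rw [Function.comp_apply, this, D.chart_zero c hc]
  chart_cross := fun c hc => by
    rw [Set.preimage_comp, D.chart_cross c hc, crossSet, Set.preimage_union,
      quarterTurn_preimage_overStrand, quarterTurn_preimage_underStrand, Set.union_comm]
  disjoint := fun c hc c' hc' h => by
    simpa only [quarterTurn_bijective.surjective.range_comp] using D.disjoint c hc c' hc' h
  flat := D.flat

theorem IsOver.mirror {D : Diagram F} {α β : CurveClass F} (h : D.IsOver α β) :
    D.mirror.IsOver β α := by
  obtain ⟨S, S', hS, hS', hD, hc, hch⟩ := h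
  refine ⟨S', S, hS', hS, hD.trans (Set.union_comm _ _), hc.trans (Set.inter_comm _ _),
    fun c hcD => ⟨?_, ?_⟩⟩
  · change (D.chart c ∘ quarterTurn) ⁻¹' S'.carrier = overStrand
    rw [Set.preimage_comp, (hch c hcD).2, quarterTurn_preimage_underStrand]
  · change (D.chart c ∘ quarterTurn) ⁻¹' S.carrier = underStrand
    rw [Set.preimage_comp, (hch c hcD).1, quarterTurn_preimage_overStrand]

open Classical in
/-- The markers `0` and `∞` exchange their roles in the mirror image. -/
theorem smoothCarrier_mirror (D : Diagram F) (I : Finset F) :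
    D.mirror.smoothCarrier D.mirror.crossings (D.crossings \ I) =
      D.smoothCarrier D.crossings I := by
  have hloc : ∀ c ∈ D.crossings,
      quarterTurn ⁻¹' localSmoothing I c = localSmoothing (D.crossings \ I) c := by
    intro c hc
    by_cases hcI : c ∈ I
    · simp [localSmoothing, hcI, quarterTurn_preimage_smoothInfty]
    · simp [localSmoothing, hcI, hc, quarterTurn_preimage_smoothZero]
  ext q
  by_cases h : ∃ c ∈ D.crossings, q ∈ Set.range (D.chart c)
  · obtain ⟨c, hc, x, rfl⟩ := h
    obtain ⟨y, rfl⟩ := quarterTurn_bijective.surjective x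
    rw [D.chart_mem_smoothCarrier _ _ hc hc]
    change _ ↔ y ∈ quarterTurn ⁻¹' localSmoothing I c
    rw [hloc c hc]
    exact D.mirror.chart_mem_smoothCarrier _ _ (c := c) hc hc y
  · push Not at h
    rw [D.mem_smoothCarrier_of_far _ _ fun c hc _ hq =>
      h c hc (Set.image_subset_range _ _ hq)]
    refine D.mirror.mem_smoothCarrier_of_far _ _ fun c hc _ hq => h c hc ?_
    obtain ⟨y, _, rfl⟩ := hq
    exact ⟨quarterTurn y, rfl⟩

end Diagram

end Surface

theorem natCast_mul_choose {k : Type*} [CommRing k] (i a : ℕ) :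
    (i : k) * (i.choose a : k) = a * (i.choose a : k) + (a + 1) * (i.choose (a + 1) : k) := by
  have h := Nat.choose_succ_right_eq i a
  rcases le_or_gt a i with hai | hai
  · have h' : (i.choose (a + 1) : k) * (a + 1) = i.choose a * (i - a) := by
      have := congrArg (Nat.cast (R := k)) h
      push_cast [Nat.cast_sub hai] at this
      exact this
    linear_combination -h'
  · simp [Nat.choose_eq_zero_of_lt hai, Nat.choose_eq_zero_of_lt (hai.trans a.lt_succ_self)]

section Algebra

variable (k : Type*) [CommRing k] [Algebra ℚ k]

/-! ### Power series expansions -/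

theorem expUnit_zpow (m : ℤ) :
    ((expUnit k ^ m : (PowerSeries k)ˣ) : PowerSeries k) =
      PowerSeries.rescale (m : k) (PowerSeries.exp k) := by
  have hnat (n : ℕ) : ((expUnit k ^ n : (PowerSeries k)ˣ) : PowerSeries k) =
      PowerSeries.rescale (n : k) (PowerSeries.exp k) := by
    rw [Units.val_pow_eq_pow_val, ← PowerSeries.exp_pow_eq_rescale_exp]; rfl
  obtain ⟨n, rfl | rfl⟩ := m.eq_nat_or_neg
  · rw [zpow_natCast, hnat]; simp
  · rw [zpow_neg, zpow_natCast, Units.inv_eq_of_mul_eq_one_right]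
    rw [hnat, PowerSeries.exp_mul_exp_eq_exp_add]
    simp

theorem substExp_T (m : ℤ) :
    substExp k (LaurentPolynomial.T m) = PowerSeries.rescale (m : k) (PowerSeries.exp k) := by
  rw [substExp, LaurentPolynomial.eval₂_T, expUnit_zpow]

theorem hCoeff_T (n : ℕ) (m : ℤ) :
    hCoeff k n (LaurentPolynomial.T m) = (m : k) ^ n * algebraMap ℚ k (1 / n.factorial) := by
  rw [hCoeff, substExp_T, PowerSeries.coeff_rescale, PowerSeries.coeff_exp]

theorem hCoeff_mul (n : ℕ) (p q : LaurentPolynomial k) :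
    hCoeff k n (p * q) = ∑ x ∈ Finset.HasAntidiagonal.antidiagonal n, hCoeff k x.1 p * hCoeff k x.2 q := by
  simp only [hCoeff, map_mul, PowerSeries.coeff_mul]

theorem hCoeff_neg_one_pow_mul (n c : ℕ) (p : LaurentPolynomial k) :
    hCoeff k n ((-1) ^ c * p) = (-1) ^ c * hCoeff k n p := by
  rcases neg_one_pow_eq_or (LaurentPolynomial k) c with h | h <;>
  rcases c.even_or_odd with hc | hc <;> simp [hCoeff, hc.neg_one_pow]

/-- The value of an inessential circle is an even function of `h`. -/
theorem evalNegHom_substExp_loopValue :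
    PowerSeries.evalNegHom (substExp k (loopValue k)) = substExp k (loopValue k) := by
  simp only [loopValue, map_sub, map_neg, substExp_T, PowerSeries.evalNegHom,
    PowerSeries.rescale_rescale]
  push_cast
  simp only [mul_neg, mul_one, neg_neg]
  ring

theorem hCoeff_loopValue_pow_of_odd {n : ℕ} (hn : Odd n) (i : ℕ) :
    hCoeff k n (loopValue k ^ i) = 0 := by
  have h : PowerSeries.evalNegHom (substExp k (loopValue k ^ i)) =
      substExp k (loopValue k ^ i) := by
    rw [map_pow, map_pow, evalNegHom_substExp_loopValue]
  have h1 := congrArg (PowerSeries.coeff n) h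
  rw [PowerSeries.evalNegHom, PowerSeries.coeff_rescale, hn.neg_one_pow] at h1
  have h2 : (2 : k) * hCoeff k n (loopValue k ^ i) = 0 := by
    rw [hCoeff]; linear_combination -h1
  have h3 : algebraMap ℚ k (1 / 2) * 2 = 1 := by
    rw [← map_ofNat (algebraMap ℚ k) 2, ← map_mul]; norm_num
  calc hCoeff k n (loopValue k ^ i)
      = algebraMap ℚ k (1 / 2) * 2 * hCoeff k n (loopValue k ^ i) := by rw [h3, one_mul]
    _ = 0 := by rw [mul_assoc, h2, mul_zero]

theorem loopCoeff_zero_zero : loopCoeff k 0 0 = 1 := by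
  simp [loopCoeff, hCoeff]

/-! ### State weights -/

/-- The weights `(ι, ζ, μ) ↦ (ι choose a) (ζ choose b) φ_r(μ)`. -/
def chooseWeight (a b r : ℕ) : ℕ → ℕ → ℕ → k :=
  fun i j m => (i.choose a : k) * (j.choose b : k) * loopCoeff k r m

/-- The weights of order `≤ n`. -/
def weightFiltration (n : ℕ) : Submodule k (ℕ → ℕ → ℕ → k) :=
  Submodule.span k {f | ∃ a b r, a + b + 2 * r ≤ n ∧ f = chooseWeight k a b r}

variable {k}

theorem mul_mem_weightFiltration (s : ℤ) {n : ℕ} {f : ℕ → ℕ → ℕ → k}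
    (hf : f ∈ weightFiltration k n) :
    (fun (i j m : ℕ) => ((s * (j - i) : ℤ) : k) * f i j m) ∈ weightFiltration k (n + 1) := by
  induction hf using Submodule.span_induction with
  | mem f hf =>
    obtain ⟨a, b, r, hn, rfl⟩ := hf
    have h : (fun (i j m : ℕ) => ((s * ((j : ℤ) - (i : ℤ)) : ℤ) : k) * chooseWeight k a b r i j m) =
        (s * (b - a) : k) • chooseWeight k a b r + (s * (b + 1) : k) • chooseWeight k a (b + 1) r -
          (s * (a + 1) : k) • chooseWeight k (a + 1) b r := by
      ext i j m
      simp only [chooseWeight, Pi.add_apply, Pi.sub_apply, Pi.smul_apply, smul_eq_mul]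
      push_cast
      linear_combination (s : k) * i.choose a * loopCoeff k r m * natCast_mul_choose (k := k) j b -
        (s : k) * j.choose b * loopCoeff k r m * natCast_mul_choose (k := k) i a
    rw [h]
    refine sub_mem (add_mem ?_ ?_) ?_ <;> refine Submodule.smul_mem _ _ (Submodule.subset_span ?_)
    · exact ⟨a, b, r, by omega, rfl⟩
    · exact ⟨a, b + 1, r, by omega, rfl⟩
    · exact ⟨a + 1, b, r, by omega, rfl⟩
  | zero => simp only [Pi.zero_apply, mul_zero]; exact zero_mem _
  | add f g _ _ hf hg =>
    convert add_mem hf hg using 1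
    ext i j m
    simp [mul_add]
  | smul c f _ hf =>
    convert Submodule.smul_mem _ c hf using 1
    ext i j m
    simp [mul_left_comm]

theorem pow_mul_loopCoeff_mem_weightFiltration (s : ℤ) (d r : ℕ) :
    (fun (i j m : ℕ) => ((s * (j - i) : ℤ) : k) ^ d * loopCoeff k r m) ∈
      weightFiltration k (d + 2 * r) := by
  induction d with
  | zero => exact Submodule.subset_span ⟨0, 0, r, by omega, by ext; simp [chooseWeight]⟩
  | succ d ih =>
    have := mul_mem_weightFiltration s ih
    rw [show d + 1 + 2 * r = d + 2 * r + 1 by omega]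
    convert this using 4
    rw [pow_succ', mul_assoc]

theorem hCoeff_mem_weightFiltration (s : ℤ) (n : ℕ) :
    (fun (i j m : ℕ) => hCoeff k n (LaurentPolynomial.T (s * (j - i)) * loopValue k ^ m)) ∈
      weightFiltration k n := by
  have h : (fun (i j m : ℕ) =>
        hCoeff k n (LaurentPolynomial.T (s * (j - i)) * loopValue k ^ m)) =
      ∑ x ∈ Finset.HasAntidiagonal.antidiagonal n, algebraMap ℚ k (1 / x.1.factorial) •
        fun (i j m : ℕ) => ((s * (j - i) : ℤ) : k) ^ x.1 * hCoeff k x.2 (loopValue k ^ m) := by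
    ext i j m
    simp only [hCoeff_mul, hCoeff_T, Finset.sum_apply, Pi.smul_apply, smul_eq_mul]
    exact Finset.sum_congr rfl fun x _ => by ring
  rw [h]
  refine sum_mem fun x hx => Submodule.smul_mem _ _ ?_
  rw [Finset.HasAntidiagonal.mem_antidiagonal] at hx
  rcases x.2.even_or_odd' with ⟨r, hr | hr⟩
  · rw [← hx, hr]
    exact pow_mul_loopCoeff_mem_weightFiltration s x.1 r
  · simp only [hCoeff_loopValue_pow_of_odd k ⟨r, hr⟩, mul_zero]
    exact zero_mem _

end Algebra

/-! ### State sums -/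

theorem lift_single {k X M : Type*} [CommRing k] [AddCommGroup M] [Module k M] (f : X → M) (x : X)
    (c : k) : Finsupp.lift M k X f (Finsupp.single x c) = c • f x := by
  simp

open Classical in
/-- Choosing a subset `T` and a splitting of both `T` and its complement amounts to choosing a
subset `K` and a splitting of both `K` and its complement. -/
theorem sum_powerset_powerset_sdiff {ι M : Type*} [AddCommMonoid M] (C : Finset ι)
    (g : Finset ι → Finset ι → Finset ι → M) :
    ∑ T ∈ C.powerset, ∑ A ∈ T.powerset, ∑ B ∈ (C \ T).powerset, g A (T \ A) B =
      ∑ K ∈ C.powerset, ∑ A ∈ K.powerset, ∑ B ∈ (C \ K).powerset, g A B (K \ A) := by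
  simp only [Finset.sum_sigma']
  refine Finset.sum_nbij' (fun x => ⟨x.2.1 ∪ x.2.2, x.2.1, x.1 \ x.2.1⟩)
    (fun x => ⟨x.2.1 ∪ x.2.2, x.2.1, x.1 \ x.2.1⟩) ?_ ?_ ?_ ?_ ?_
  all_goals
    rintro ⟨T, A, B⟩ h
    simp only [Finset.mem_sigma, Finset.mem_powerset] at h ⊢
    obtain ⟨hT, hA, hB⟩ := h
    have hAB : Disjoint A B := Finset.disjoint_left.2 fun x hxA hxB =>
      (Finset.mem_sdiff.1 (hB hxB)).2 (hA hxA)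
  · grind
  · grind
  · simp only [Sigma.mk.injEq, heq_eq_eq]
    simp [Finset.union_sdiff_cancel_left hAB, Finset.union_sdiff_of_subset hA]
  · simp only [Sigma.mk.injEq, heq_eq_eq]
    simp [Finset.union_sdiff_cancel_left hAB, Finset.union_sdiff_of_subset hA]
  · rw [Finset.union_sdiff_cancel_left hAB]

section Surface

variable {k : Type*} [CommRing k] {F : Type*} [TopologicalSpace F]
  [ChartedSpace (EuclideanHalfSpace 2) F] [T2Space F]

open Classical in
/-- The sum over all states of `D`, with the weight `(-1) ^ |C| * f ι ζ μ`. -/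
def stateSum (D : Diagram F) (f : ℕ → ℕ → ℕ → k) : CurveClass F →₀ k :=
  ∑ I ∈ D.crossings.powerset, Finsupp.single (D.stateClass I)
    ((-1) ^ D.crossings.card * f I.card (D.crossings \ I).card (D.inessentialCount I))

theorem stateSum_add (D : Diagram F) (f g : ℕ → ℕ → ℕ → k) :
    stateSum D (f + g) = stateSum D f + stateSum D g := by
  simp only [stateSum, Pi.add_apply, mul_add, Finsupp.single_add, Finset.sum_add_distrib]

theorem stateSum_smul (D : Diagram F) (c : k) (f : ℕ → ℕ → ℕ → k) :
    stateSum D (c • f) = c • stateSum D f := by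
  simp only [stateSum, Pi.smul_apply, smul_eq_mul, mul_left_comm _ c, Finset.smul_sum,
    Finsupp.smul_single]

open Classical in
theorem stateSum_mirror (D : Diagram F) (f : ℕ → ℕ → ℕ → k) :
    stateSum D.mirror f = stateSum D fun i j => f j i := by
  refine (Finset.sum_nbij' (fun I => D.crossings \ I) (fun I => D.crossings \ I) ?_ ?_ ?_ ?_
    ?_).symm
  · exact fun I _ => Finset.mem_powerset.2 Finset.sdiff_subset
  · exact fun I _ => Finset.mem_powerset.2 Finset.sdiff_subset
  · exact fun I hI => Finset.sdiff_sdiff_eq_self (Finset.mem_powerset.1 hI)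
  · exact fun I hI => Finset.sdiff_sdiff_eq_self (Finset.mem_powerset.1 hI)
  · intro I hI
    have hc := D.smoothCarrier_mirror I
    have h : D.mirror.crossings \ (D.crossings \ I) = I :=
      Finset.sdiff_sdiff_eq_self (Finset.mem_powerset.1 hI)
    rw [Diagram.stateClass_congr hc, Diagram.inessentialCount_congr hc, h]
    rfl

open Classical in
theorem phiStar_chi_single (φ : ℕ → k) (Q : MvPolynomial (Fin 2) k) (D : Diagram F) :
    phiStar φ (chi Q (Finsupp.single D 1)) =
      ∑ K ∈ D.crossings.powerset, Finsupp.single (D.stateClass K)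
        ((-1) ^ D.crossings.card * φ (D.inessentialCount K) *
          ∑ A ∈ K.powerset, ∑ B ∈ (D.crossings \ K).powerset,
            Q.coeff (Finsupp.single 0 A.card + Finsupp.single 1 B.card)) := by
  have key : ∀ T ∈ D.crossings.powerset, ∀ A ∈ T.powerset,
      phiStar φ (Finsupp.single (D.smooth T A) ((-1) ^ T.card *
        Q.coeff (Finsupp.single 0 A.card + Finsupp.single 1 (T \ A).card))) =
      ∑ B ∈ (D.crossings \ T).powerset, Finsupp.single (D.stateClass (A ∪ B))
        ((-1) ^ D.crossings.card * φ (D.inessentialCount (A ∪ B)) *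
          Q.coeff (Finsupp.single 0 A.card + Finsupp.single 1 (T \ A).card)) := by
    intro T hT A hA
    rw [Finset.mem_powerset] at hT hA
    rw [phiStar, lift_single, Finset.smul_sum]
    simp only [Finsupp.smul_single, smul_eq_mul]
    refine Finset.sum_congr rfl fun B hB => ?_
    have hc := D.smoothCarrier_smooth hA (Finset.mem_powerset.1 hB)
    rw [Diagram.stateClass_congr hc, Diagram.inessentialCount_congr hc]
    have hcard : T.card + (D.smooth T A).crossings.card = D.crossings.card := by
      rw [add_comm]
      exact Finset.card_sdiff_add_card_eq_card hT
    rw [← hcard, pow_add]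
    congr 1
    ring
  have hchi : chi Q (Finsupp.single D 1) = ∑ T ∈ D.crossings.powerset, ∑ A ∈ T.powerset,
      Finsupp.single (D.smooth T A) ((-1) ^ T.card *
        Q.coeff (Finsupp.single 0 A.card + Finsupp.single 1 (T \ A).card)) := by
    simp [chi]
  simp only [hchi, map_sum]
  rw [Finset.sum_congr rfl fun T hT => Finset.sum_congr rfl (key T hT)]
  rw [sum_powerset_powerset_sdiff D.crossings fun A A' B =>
    Finsupp.single (D.stateClass (A ∪ B)) ((-1) ^ D.crossings.card *
      φ (D.inessentialCount (A ∪ B)) *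
        Q.coeff (Finsupp.single 0 A.card + Finsupp.single 1 A'.card))]
  refine Finset.sum_congr rfl fun K _ => ?_
  simp only [Finset.mul_sum, Finsupp.single_finsetSum]
  refine Finset.sum_congr rfl fun A hA => ?_
  rw [Finset.union_sdiff_of_subset (Finset.mem_powerset.1 hA)]

theorem single_add_single_inj {a b i j : ℕ} :
    (Finsupp.single 0 a + Finsupp.single 1 b : Fin 2 →₀ ℕ) =
      Finsupp.single 0 i + Finsupp.single 1 j ↔ i = a ∧ j = b := by
  constructor
  · intro h
    have h0 := DFunLike.congr_fun h 0
    have h1 := DFunLike.congr_fun h 1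
    simp at h0 h1
    exact ⟨h0.symm, h1.symm⟩
  · rintro ⟨rfl, rfl⟩
    rfl

theorem sum_powerset_ite_card {ι : Type*} (K : Finset ι) (a : ℕ) :
    ∑ A ∈ K.powerset, (if A.card = a then (1 : k) else 0) = K.card.choose a := by
  rw [← Finset.sum_filter, ← Finset.powersetCard_eq_filter, Finset.sum_const,
    Finset.card_powersetCard, nsmul_one]

variable [Algebra ℚ k]

theorem phi_chi_monomial_single (a b r : ℕ) (D : Diagram F) :
    phi r (chi (MvPolynomial.monomial (Finsupp.single 0 a + Finsupp.single 1 b) (1 : k))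
      (Finsupp.single D 1)) = stateSum D (chooseWeight k a b r) := by
  classical
  rw [phi, phiStar_chi_single, stateSum]
  refine Finset.sum_congr rfl fun K _ => ?_
  simp only [MvPolynomial.coeff_monomial, single_add_single_inj, chooseWeight, ite_and,
    Finset.sum_ite_irrel, sum_powerset_ite_card]
  rw [← sum_powerset_ite_card (k := k) K a]
  congr 1
  simp only [Finset.sum_const_zero, Finset.sum_mul, Finset.mul_sum]
  refine Finset.sum_congr rfl fun A _ => ?_
  split_ifs <;> ring

open Classical in
theorem bracketCoeff_eq_stateSum (n : ℕ) (D : Diagram F) :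
    bracketCoeff k n D = stateSum D fun i j m =>
      hCoeff k n (LaurentPolynomial.T (j - i) * loopValue k ^ m) := by
  have h : ∀ p : CurveClass F →₀ LaurentPolynomial k,
      p.mapRange (hCoeff k n) (hCoeff_zero k n) =
        Finsupp.mapRange.addMonoidHom (((PowerSeries.coeff n).toAddMonoidHom.comp
          (substExp k : LaurentPolynomial k →+ PowerSeries k))) p := by
    intro p
    ext
    rfl
  rw [bracketCoeff, h, bracket, map_sum, stateSum]
  refine Finset.sum_congr rfl fun I _ => ?_
  rw [← h, Finsupp.mapRange_single, mul_assoc, hCoeff_neg_one_pow_mul]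

/-- The operator that sends a curve system `γ` to the state sum of the diagram `d γ`. -/
def stateOperator (d : CurveClass F → Diagram F) :
    (ℕ → ℕ → ℕ → k) →ₗ[k] Module.End k (CurveClass F →₀ k) where
  toFun f := Finsupp.lift _ k (CurveClass F) fun γ => stateSum (d γ) f
  map_add' f g := by
    refine Finsupp.lhom_ext fun γ c => ?_
    simp only [LinearMap.add_apply, lift_single, stateSum_add, smul_add]
  map_smul' c f := by
    refine Finsupp.lhom_ext fun γ c => ?_
    simp only [LinearMap.smul_apply, RingHom.id_apply, lift_single, stateSum_smul]
    exact smul_comm _ _ _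

theorem stateOperator_chooseWeight (d : CurveClass F → Diagram F) (a b r : ℕ) :
    stateOperator d (chooseWeight k a b r) =
      phi r ∘ₗ chi (MvPolynomial.monomial (Finsupp.single 0 a + Finsupp.single 1 b) (1 : k)) ∘ₗ
        Finsupp.lmapDomain k k d := by
  refine Finsupp.lhom_ext fun γ c => ?_
  have h : (Finsupp.single γ c : CurveClass F →₀ k) = c • Finsupp.single γ 1 := by simp
  rw [h, map_smul, map_smul]
  congr 1
  simp [stateOperator, Finsupp.mapDomain_single, phi_chi_monomial_single]

/-! ### The filtration -/

theorem CurveSystem.inessentialCount_toDiagram (S : CurveSystem F) (I : Finset F) :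
    S.toDiagram.inessentialCount I = 0 := by
  have h : inessentialComponents S.carrier = ∅ := by
    refine Set.eq_empty_of_forall_notMem fun K ⟨⟨x, hx, hK⟩, hd⟩ => S.essential x hx (hK ▸ hd)
  change (inessentialComponents (S.toDiagram.smoothCarrier _ I)).ncard = 0
  rw [S.smoothCarrier_toDiagram, h, Set.ncard_empty]

theorem CurveSystem.stateClass_toDiagram (S : CurveSystem F) (I : Finset F) :
    S.toDiagram.stateClass I = ⟦S⟧ := by
  refine Quotient.sound ?_
  change Isotopic (essentialPart (S.toDiagram.smoothCarrier _ I)) S.carrier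
  rw [S.smoothCarrier_toDiagram]
  have h : essentialPart S.carrier = S.carrier :=
    Set.Subset.antisymm (fun _ hx => hx.1) fun x hx => ⟨hx, S.essential x hx⟩
  rw [h]
  exact Isotopic.rfl' _

theorem phi_zero_comp_chi_comp_inclusion (Q : MvPolynomial (Fin 2) k) :
    phi 0 ∘ₗ chi Q ∘ₗ inclusion =
      Q.coeff 0 • (1 : Module.End k (CurveClass F →₀ k)) := by
  refine Finsupp.lhom_ext fun γ c => ?_
  have h : (Finsupp.single γ c : CurveClass F →₀ k) = c • Finsupp.single γ 1 := by simp
  rw [h, map_smul, map_smul]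
  congr 1
  have hC : γ.out.toDiagram.crossings = ∅ := rfl
  simp [inclusion, Finsupp.mapDomain_single, phi, phiStar_chi_single, hC,
    CurveSystem.stateClass_toDiagram, CurveSystem.inessentialCount_toDiagram,
    loopCoeff_zero_zero]

theorem IsWord.mem_combFiltration {n p : ℕ} {f : Module.End k (CurveClass F →₀ k)}
    (hf : IsWord n f) (h : n ≤ p) : f ∈ combFiltration F k p :=
  Submodule.subset_span ⟨n, h, hf⟩

theorem isWord_one : IsWord 0 (1 : Module.End k (CurveClass F →₀ k)) := by
  have := IsWord.base (F := F) 0 (1 : MvPolynomial (Fin 2) k) (MvPolynomial.isHomogeneous_one _ _)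
  rwa [phi_zero_comp_chi_comp_inclusion, MvPolynomial.coeff_zero_one, one_smul] at this

theorem combFiltration_mono : Monotone (combFiltration F k) := fun _ _ h =>
  Submodule.span_mono fun _ ⟨n, hn, hf⟩ => ⟨n, hn.trans h, hf⟩

theorem step_mem_combFiltration {p : ℕ} {f : Module.End k (CurveClass F →₀ k)}
    (hf : f ∈ combFiltration F k p) {α : CurveClass F} {d : CurveClass F → Diagram F}
    (hd : ∀ γ, (d γ).IsOver α γ) (r : ℕ) {q : ℕ} {Q : MvPolynomial (Fin 2) k}
    (hQ : Q.IsHomogeneous q) :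
    phi r ∘ₗ chi Q ∘ₗ Finsupp.lmapDomain k k d ∘ₗ f ∈ combFiltration F k (p + (2 * r + q)) := by
  induction hf using Submodule.span_induction with
  | mem f hf =>
    obtain ⟨n, hn, hf⟩ := hf
    exact (IsWord.step n f hf α d hd r q Q hQ).mem_combFiltration (by omega)
  | zero => simp only [LinearMap.comp_zero, zero_mem]
  | add f g _ _ hf hg => simpa only [LinearMap.comp_add] using add_mem hf hg
  | smul c f _ hf => simpa only [LinearMap.comp_smul] using Submodule.smul_mem _ c hf

theorem IsWord.mul_mem_combFiltration {n p : ℕ} {f g : Module.End k (CurveClass F →₀ k)}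
    (hf : IsWord n f) (hg : g ∈ combFiltration F k p) : f * g ∈ combFiltration F k (n + p) := by
  induction hf with
  | base q Q _ =>
    rw [phi_zero_comp_chi_comp_inclusion, smul_mul_assoc, one_mul]
    exact Submodule.smul_mem _ _ (combFiltration_mono (Nat.le_add_left _ _) hg)
  | step n f _ α d hd r q Q hQ ih =>
    rw [add_right_comm]
    exact step_mem_combFiltration ih hd r hQ

variable (k F) in
theorem isFilteredSubalgebra_combFiltration : IsFilteredSubalgebra (combFiltration F k) where
  mono := combFiltration_mono
  one_mem := isWord_one.mem_combFiltration le_rfl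
  mul_mem i j f hf g hg := by
    induction hf using Submodule.span_induction with
    | mem f hf =>
      obtain ⟨n, hn, hf⟩ := hf
      exact combFiltration_mono (by omega) (hf.mul_mem_combFiltration hg)
    | zero => simp only [zero_mul, zero_mem]
    | add f f' _ _ hf hf' => simpa only [add_mul] using add_mem hf hf'
    | smul c f _ hf => simpa only [smul_mul_assoc] using Submodule.smul_mem _ c hf

theorem stateOperator_mem_combFiltration {α : CurveClass F} {d : CurveClass F → Diagram F}
    (hd : ∀ γ, (d γ).IsOver α γ) {n : ℕ} {f : ℕ → ℕ → ℕ → k} (hf : f ∈ weightFiltration k n) :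
    stateOperator d f ∈ combFiltration F k n := by
  suffices h : weightFiltration k n ≤ (combFiltration F k n).comap (stateOperator d) from h hf
  refine Submodule.span_le.2 ?_
  rintro _ ⟨a, b, r, hn, rfl⟩
  have hQ : (MvPolynomial.monomial (Finsupp.single 0 a + Finsupp.single 1 b : Fin 2 →₀ ℕ)
      (1 : k)).IsHomogeneous (a + b) := MvPolynomial.isHomogeneous_monomial _ (by simp)
  have := step_mem_combFiltration (isWord_one.mem_combFiltration le_rfl) hd r hQ
  rw [SetLike.mem_coe, Submodule.mem_comap, stateOperator_chooseWeight]
  exact combFiltration_mono (by omega) this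

variable (k) in
theorem isDifferentiable_kauffmanStar (w : OverChoice F) :
    (kauffmanStar k w).IsDifferentiable (combFiltration F k) := by
  intro n a
  constructor
  · induction a using Finsupp.induction_linear with
    | zero => rw [map_zero]; exact zero_mem _
    | add a b ha hb => rw [map_add]; exact add_mem ha hb
    | single α c =>
      have h : (kauffmanStar k w).coeff n (Finsupp.single α c) =
          c • stateOperator (w.diagram α) fun i j m =>
            hCoeff k n (LaurentPolynomial.T (1 * (j - i)) * loopValue k ^ m) := by
        simp [kauffmanStar, stateOperator, bracketCoeff_eq_stateSum]
      rw [h]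
      exact Submodule.smul_mem _ _
        (stateOperator_mem_combFiltration (w.isOver α) (hCoeff_mem_weightFiltration 1 n))
  · induction a using Finsupp.induction_linear with
    | zero => rw [map_zero]; exact zero_mem _
    | add a b ha hb => rw [map_add]; exact add_mem ha hb
    | single α c =>
      have h : ((kauffmanStar k w).coeff n).flip (Finsupp.single α c) =
          c • stateOperator (fun γ => (w.diagram γ α).mirror) fun i j m =>
            hCoeff k n (LaurentPolynomial.T (-1 * (j - i)) * loopValue k ^ m) := by
        refine Finsupp.lhom_ext fun γ e => ?_
        simp [kauffmanStar, stateOperator, bracketCoeff_eq_stateSum, stateSum_mirror,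
          smul_comm c e]
      rw [h]
      exact Submodule.smul_mem _ _ (stateOperator_mem_combFiltration
        (fun γ => (w.isOver γ α).mirror) (hCoeff_mem_weightFiltration (-1) n))

end Surface

end KauffmanStar

end

theorem mainTheorem7 (k : Type*) [CommRing k] [Algebra ℚ k]
    (F : Type*) [TopologicalSpace F] [T2Space F] [CompactSpace F] [ConnectedSpace F]
    [ChartedSpace (EuclideanHalfSpace 2) F] [IsManifold (𝓡∂ 2) ∞ F] [KauffmanStar.OrientedAtlas F]
    (w : KauffmanStar.OverChoice F) :
    KauffmanStar.IsFilteredSubalgebra (KauffmanStar.combFiltration F k) ∧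
      (KauffmanStar.kauffmanStar k w).IsDifferentiable (KauffmanStar.combFiltration F k) :=
  ⟨KauffmanStar.isFilteredSubalgebra_combFiltration k F,
    KauffmanStar.isDifferentiable_kauffmanStar k w⟩
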